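/- Let $m\le n$ and equip $\mathbb R^{m\times n}$ with the inner product $\langle X,Y\rangle=\sum_{i,j}X_{ij}Y_{ij}$ (whose norm is the Frobenius norm); gradients are taken with respect to it. For $X\in\mathbb R^{m\times n}$ let $\sigma_1(X)\ge\dots\ge\sigma_m(X)\ge 0$ be its singular values. Let $f:\mathbb R^{m\times n}\to\mathbb R$ be $L$-Lipschitz smooth, i.e. differentiable with $L$-Lipschitz gradient. Let $\kappa:[0,\infty)\to\mathbb R$ be concave and non-decreasing with $\kappa(0)=0$, differentiable (one-sidedly at $0$) with $\rho$-Lipschitz derivative $\kappa'$, where $\kappa'$ is non-differentiable at only finitely many points; put $\kappa_0=\kappa'(0)$. Let $\mu\ge 0$ and $$\bar f(X)=f(X)+\mu\sum_{i=1}^m\bigl(\kappa(\sigma_i(X))-\kappa_0\,\sigma_i(X)\bigr).$$ Let $X_t\in\mathbb R^{m\times n}$, $u_t\in\mathbb R^m$, $v_t\in\mathbb R^n$, $\alpha,\beta\in\mathbb R$ and $S=\alpha X_t+\beta u_tv_t^\top$, and let $S=U_S\,\mathrm{Diag}(\sigma_1(S),\dots,\sigma_m(S))\,V_S^\top$ be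 any singular value decomposition of $S$, where $U_S\in\mathbb R^{m\times m}$ and $V_S\in\mathbb R^{n\times m}$ satisfy $U_S^\top U_S=V_S^\top V_S=I_m$. Then $\bar f$ is differentiable at $S$ with gradient $$\nabla\bar f(S)=\nabla f(S)+\mu\,U_S\,\mathrm{Diag}(w)\,V_S^\top,\qquad w_i=\kappa'(\sigma_i(S))-\kappa_0\quad(i=1,\dots,m),$$ and the partial derivatives of $(\alpha,\beta)\mapsto\bar f(\alpha X_t+\beta u_tv_t^\top)$ exist and are $$\frac{\partial\bar f(S)}{\partial\alpha}=\langle X_t,\nabla\bar f(S)\rangle,\qquad \frac{\partial\bar f(S)}{\partial\beta}=u_t^\top\,\nabla\bar f(S)\,v_t .$$ -/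

import Mathlib

open scoped Matrix Gradient NNReal

noncomputable section

namespace LowRankGradient

attribute [local instance] Matrix.frobeniusNormedAddCommGroup Matrix.frobeniusNormedSpace

/-- The inner product `⟨X, Y⟩ = ∑ i j, X i j * Y i j` on real matrices; the norm that it induces is
the Frobenius norm. All gradients of functions of a matrix are taken with respect to it. -/
instance frobeniusInnerProductSpace {m n : ℕ} :
    InnerProductSpace ℝ (Matrix (Fin m) (Fin n) ℝ) where
  inner X Y := ∑ i, ∑ j, X i j * Y i j
  norm_sq_eq_re_inner X := by
    have h : 0 ≤ ∑ i, ∑ j, X i j * X i j :=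
      Finset.sum_nonneg fun i _ => Finset.sum_nonneg fun j _ => mul_self_nonneg _
    rw [Matrix.frobenius_norm_def, ← Real.sqrt_eq_rpow, Real.sq_sqrt]
    · simp [pow_two]
    · simpa [pow_two] using h
  conj_inner_symm X Y := by simp [mul_comm]
  add_left X Y Z := by simp [add_mul, Finset.sum_add_distrib]
  smul_left X Y r := by simp [mul_assoc, Finset.mul_sum]

/-- `sigma X i` is the `i`-th largest singular value of `X` (counted from `0`), for `i < m`. -/
def sigma {m n : ℕ} (X : Matrix (Fin m) (Fin n) ℝ) (i : Fin m) : ℝ :=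
  (Matrix.toEuclideanLin X).singularValues i

/-- `S = U Diag(σ₁(S), …, σₘ(S)) Vᵀ` is a singular value decomposition of the `m × n` matrix `S`
(`m ≤ n`): `U` is an orthogonal `m × m` matrix and `V` an `n × m` matrix with orthonormal
columns. -/
def IsSVD {m n : ℕ} (S : Matrix (Fin m) (Fin n) ℝ) (U : Matrix (Fin m) (Fin m) ℝ)
    (V : Matrix (Fin n) (Fin m) ℝ) : Prop :=
  Uᵀ * U = 1 ∧ Vᵀ * V = 1 ∧ S = U * Matrix.diagonal (sigma S) * Vᵀ

/-- The derivative of `κ : [0, ∞) → ℝ` (one-sided at `0`). -/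
def kappaDeriv (κ : ℝ → ℝ) (x : ℝ) : ℝ :=
  derivWithin κ (Set.Ici 0) x

/-- The class of functions `κ : [0, ∞) → ℝ` defining the regularizers: concave, non-decreasing,
`ρ`-Lipschitz smooth (differentiable with `ρ`-Lipschitz derivative), the derivative being
non-differentiable at finitely many points only, and `κ 0 = 0`.
The values of `κ` at negative numbers are irrelevant. -/
structure IsPenalty (κ : ℝ → ℝ) (ρ : ℝ≥0) : Prop where
  concave : ConcaveOn ℝ (Set.Ici 0) κ
  monotone : MonotoneOn κ (Set.Ici 0)
  differentiable : DifferentiableOn ℝ κ (Set.Ici 0)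
  lipschitz_deriv : LipschitzOnWith ρ (kappaDeriv κ) (Set.Ici 0)
  finite_nonsmooth :
    {x : ℝ | 0 ≤ x ∧ ¬ DifferentiableWithinAt ℝ (kappaDeriv κ) (Set.Ici 0) x}.Finite
  map_zero : κ 0 = 0

/-- A function of a matrix is `L`-Lipschitz smooth: at every point it has a gradient, and
the gradient is `L`-Lipschitz in the Frobenius norm. -/
def IsLipschitzSmooth {m n : ℕ} (f : Matrix (Fin m) (Fin n) ℝ → ℝ) (L : ℝ≥0) : Prop :=
  (∀ X, HasGradientAt f (∇ f X) X) ∧ LipschitzWith L (∇ f)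

/-- `ḡ(X) = μ ∑ᵢ (κ(σᵢ(X)) - κ₀ σᵢ(X))` with `κ₀ = κ'(0)`. -/
def gBar {m n : ℕ} (κ : ℝ → ℝ) (μ : ℝ) (X : Matrix (Fin m) (Fin n) ℝ) : ℝ :=
  μ * ∑ i, (κ (sigma X i) - kappaDeriv κ 0 * sigma X i)

/-- The augmented loss `f̄ = f + ḡ`. -/
def fBar {m n : ℕ} (f : Matrix (Fin m) (Fin n) ℝ → ℝ) (κ : ℝ → ℝ) (μ : ℝ)
    (X : Matrix (Fin m) (Fin n) ℝ) : ℝ :=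
  f X + gBar κ μ X

end LowRankGradient

end

attribute [local instance] Matrix.frobeniusNormedAddCommGroup Matrix.frobeniusNormedSpace

/-!
Put `θ x = κ'(0) x - κ x` and `Φ X = ∑ i, θ (σᵢ X)`, so that `ḡ = -μ Φ`. On `[0, ∞)` the function
`θ` is convex, because `κ` is concave, and so is `x ↦ ρ / 2 * x ^ 2 - θ x`, because `κ'` is
`ρ`-Lipschitz. Both have derivative `0` at `0`, hence monotone nonnegative derivatives. For any
convex `θ` with monotone nonnegative derivative, `spectral_subgradient` says that `U Diag(θ'(σ(S)))
Vᵀ` is a subgradient of `Φ` at `S = U Diag(σ(S)) Vᵀ`; it comes from the scalar tangent inequality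
summed over the singular values, together with von Neumann's trace inequality
`sum_mul_inner_map_le`. Applied to both functions, and since `∑ i, σᵢ(Y) ^ 2` is the squared
Frobenius norm of `Y` (`sum_sigma_sq`), it bounds the first-order remainder of `Φ` at `S` between
`0` and `ρ / 2 * ‖Y - S‖ ^ 2` (`IsPenalty.abs_spectral_remainder_le`). Hence `Φ` is differentiable
at `S` with the asserted gradient, whichever singular value decomposition was chosen; no
perturbation theory of singular vectors is needed. The partial derivatives follow by the chain
rule.

The trace inequality rests on a bound for `∑ i j, w i * τ j * D i j` with `w`, `τ` decreasing and
`D` doubly substochastic, proved by exhibiting a feasible solution of the dual linear programme.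
-/

namespace LowRankGradient

/-! ### Sums over doubly substochastic matrices -/

/-- Optimal dual variables for maximizing `∑ i j, w i * τ j * D i j` over doubly substochastic `D`.
The points `(w k, τ k)` with `k ≥ i` are the corners of a staircase in the rectangle with corners
`(0, 0)` and `(w i, τ i)`; it cuts the area `w i * τ i` into vertical strips, of total area `a i`,
and horizontal strips, of total area `b i`. -/
lemma exists_rearrangement_certificate {w τ : ℕ → ℝ} (hw : Antitone w) (hw0 : ∀ k, 0 ≤ w k)
    (hτ : Antitone τ) (hτ0 : ∀ k, 0 ≤ τ k) {m : ℕ} (hwm : ∀ k, m ≤ k → w k = 0) :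
    ∃ a b : ℕ → ℝ, (∀ i, 0 ≤ a i) ∧ (∀ j, 0 ≤ b j) ∧ (∀ i, a i + b i = w i * τ i) ∧
      (∀ i j, w i * τ j ≤ a i + b j) ∧ ∀ j, m ≤ j → b j = 0 := by
  have hw' : ∀ k, w (k + 1) ≤ w k := fun k => hw k.le_succ
  have hτ' : ∀ k, τ (k + 1) ≤ τ k := fun k => hτ k.le_succ
  let a : ℕ → ℝ := fun i => ∑ k ∈ Finset.Ico i m, (w k - w (k + 1)) * τ k
  let b : ℕ → ℝ := fun j => ∑ k ∈ Finset.Ico j m, (τ k - τ (k + 1)) * w (k + 1)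
  have ha0 : ∀ i, 0 ≤ a i := fun i =>
    Finset.sum_nonneg fun k _ => mul_nonneg (sub_nonneg.2 (hw' k)) (hτ0 k)
  have hb0 : ∀ j, 0 ≤ b j := fun j =>
    Finset.sum_nonneg fun k _ => mul_nonneg (sub_nonneg.2 (hτ' k)) (hw0 _)
  have ha_succ : ∀ i, a i = (w i - w (i + 1)) * τ i + a (i + 1) := by
    intro i
    rcases lt_or_ge i m with h | h
    · exact Finset.sum_eq_sum_Ico_succ_bot h _
    · simp [a, Finset.Ico_eq_empty_of_le h, Finset.Ico_eq_empty_of_le (h.trans i.le_succ),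
        hwm i h, hwm (i + 1) (h.trans i.le_succ)]
  have hb_succ : ∀ j, b j = (τ j - τ (j + 1)) * w (j + 1) + b (j + 1) := by
    intro j
    rcases lt_or_ge j m with h | h
    · exact Finset.sum_eq_sum_Ico_succ_bot h _
    · simp [b, Finset.Ico_eq_empty_of_le h, Finset.Ico_eq_empty_of_le (h.trans j.le_succ),
        hwm (j + 1) (h.trans j.le_succ)]
  have hab : ∀ i, a i + b i = w i * τ i := by
    have hstep : ∀ i, a i + b i - w i * τ i = a (i + 1) + b (i + 1) - w (i + 1) * τ (i + 1) := by
      intro i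
      rw [ha_succ i, hb_succ i]
      ring
    have hconst : ∀ i d, a i + b i - w i * τ i = a (i + d) + b (i + d) - w (i + d) * τ (i + d) := by
      intro i d
      induction d with
      | zero => rfl
      | succ d ih => rw [ih, hstep, add_assoc]
    intro i
    -- The defect of the identity is constant in `i`, and vanishes beyond `m`.
    have h := hconst i m
    have hm : m ≤ i + m := Nat.le_add_left m i
    simp only [a, b, Finset.Ico_eq_empty_of_le hm, hwm _ hm] at h ⊢
    simp at h
    linarith
  refine ⟨a, b, ha0, hb0, hab, fun i j => ?_, fun j hj => by
    simp [b, Finset.Ico_eq_empty_of_le hj]⟩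
  rcases le_total i j with hij | hij
  · have h : a j + τ j * (w i - w j) ≤ a i := by
      induction j, hij using Nat.le_induction with
      | base => simp
      | succ j hij ih =>
        have h1 := ha_succ j
        have h2 := mul_le_mul_of_nonneg_right (hτ' j)
          (sub_nonneg.2 (hw (hij.trans j.le_succ)) : 0 ≤ w i - w (j + 1))
        nlinarith
    nlinarith [hab j]
  · have h : b i + w i * (τ j - τ i) ≤ b j := by
      induction i, hij using Nat.le_induction with
      | base => simp
      | succ i hij ih =>
        have h1 := hb_succ i
        have h2 := mul_le_mul_of_nonneg_right (hw' i)
          (sub_nonneg.2 (hτ hij) : 0 ≤ τ j - τ i)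
        nlinarith
    nlinarith [hab i]

lemma sum_mul_mul_substochastic_le {m n : ℕ} {w τ : ℕ → ℝ} (hw : Antitone w)
    (hw0 : ∀ k, 0 ≤ w k) (hτ : Antitone τ) (hτ0 : ∀ k, 0 ≤ τ k) (hwm : ∀ k, m ≤ k → w k = 0)
    {D : Fin m → Fin n → ℝ} (hD : ∀ i j, 0 ≤ D i j) (hrow : ∀ i, ∑ j, D i j ≤ 1)
    (hcol : ∀ j, ∑ i, D i j ≤ 1) :
    ∑ i : Fin m, ∑ j : Fin n, w i * τ j * D i j ≤ ∑ i : Fin m, w i * τ i := by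
  obtain ⟨a, b, ha, hb, hab, hle, hbm⟩ := exists_rearrangement_certificate hw hw0 hτ hτ0 hwm
  calc ∑ i : Fin m, ∑ j : Fin n, w i * τ j * D i j
      ≤ ∑ i : Fin m, ∑ j : Fin n, (a i * D i j + b j * D i j) := by
        gcongr with i _ j _
        rw [← add_mul]
        exact mul_le_mul_of_nonneg_right (hle i j) (hD i j)
    _ = ∑ i : Fin m, a i * ∑ j, D i j + ∑ j : Fin n, b j * ∑ i, D i j := by
        simp only [Finset.sum_add_distrib, Finset.mul_sum]
        congr 1
        exact Finset.sum_comm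
    _ ≤ ∑ i : Fin m, a i + ∑ j : Fin n, b j := by
        gcongr with i _ j _
        · exact mul_le_of_le_one_right (ha i) (hrow i)
        · exact mul_le_of_le_one_right (hb j) (hcol j)
    _ ≤ ∑ i : Fin m, a i + ∑ j : Fin m, b j := by
        gcongr
        rw [Fin.sum_univ_eq_sum_range b, Fin.sum_univ_eq_sum_range b]
        calc ∑ j ∈ Finset.range n, b j
            = ∑ j ∈ Finset.range n with j < m, b j :=
              (Finset.sum_filter_of_ne fun j _ hj => not_le.1 fun h => hj (hbm j h)).symm
          _ ≤ ∑ j ∈ Finset.range m, b j :=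
              Finset.sum_le_sum_of_subset_of_nonneg (fun j hj => by simp at hj ⊢; exact hj.2)
                fun j _ _ => hb j
    _ = ∑ i : Fin m, w i * τ i := by
        rw [← Finset.sum_add_distrib]
        exact Finset.sum_congr rfl fun i _ => hab i

/-! ### Von Neumann's trace inequality -/

section LinearMap

variable {E F : Type*} [NormedAddCommGroup E] [InnerProductSpace ℝ E] [FiniteDimensional ℝ E]
  [NormedAddCommGroup F] [InnerProductSpace ℝ F] [FiniteDimensional ℝ F]

/-- An orthonormal eigenbasis of `T* T`, in the order of the singular values of `T`. -/
lemma exists_orthonormalBasis_inner_map_eq (T : E →ₗ[ℝ] F) {n : ℕ}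
    (hn : Module.finrank ℝ E = n) :
    ∃ q : OrthonormalBasis (Fin n) ℝ E, ∀ i j,
      inner ℝ (T (q i)) (T (q j)) = if i = j then T.singularValues j ^ 2 else 0 := by
  refine ⟨T.isSymmetric_adjoint_comp_self.eigenvectorBasis hn, fun i j => ?_⟩
  have h := T.isSymmetric_adjoint_comp_self.apply_eigenvectorBasis hn j
  rw [← LinearMap.adjoint_inner_right, ← LinearMap.comp_apply, h, inner_smul_right,
    OrthonormalBasis.inner_eq_ite, ← T.sq_singularValues_fin hn]
  simp

/-- Both sides are the trace of `T* T`. -/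
lemma sum_norm_map_sq_eq_sum_singularValues_sq (T : E →ₗ[ℝ] F) {n : ℕ}
    (b : OrthonormalBasis (Fin n) ℝ E) :
    ∑ i, ‖T (b i)‖ ^ 2 = ∑ i : Fin n, T.singularValues i ^ 2 := by
  have hn : Module.finrank ℝ E = n := by
    simpa using Module.finrank_eq_card_basis b.toBasis
  obtain ⟨q, hq⟩ := exists_orthonormalBasis_inner_map_eq T hn
  have key : ∀ c : OrthonormalBasis (Fin n) ℝ E,
      ∑ i, ‖T (c i)‖ ^ 2 = (T.adjoint ∘ₗ T).trace ℝ E := by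
    intro c
    rw [LinearMap.trace_eq_sum_inner _ c]
    simp [LinearMap.adjoint_inner_right]
  rw [key b, ← key q]
  refine Finset.sum_congr rfl fun i _ => ?_
  rw [← real_inner_self_eq_norm_sq, hq, if_pos rfl]

/-- Right and left singular vectors of `T`. The left singular vectors belonging to a vanishing
singular value are `0`, so that the family `p` is orthonormal only up to zero vectors; Bessel's
inequality still holds for it. -/
lemma exists_singular_vectors (T : E →ₗ[ℝ] F) {n : ℕ} (hn : Module.finrank ℝ E = n) :
    ∃ (q : OrthonormalBasis (Fin n) ℝ E) (p : Fin n → F),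
      (∀ j, T (q j) = T.singularValues j • p j) ∧ (∀ j, ‖p j‖ ≤ 1) ∧
      ∀ y, ∑ j, inner ℝ (p j) y ^ 2 ≤ ‖y‖ ^ 2 := by
  obtain ⟨q, hq⟩ := exists_orthonormalBasis_inner_map_eq T hn
  let p : Fin n → F := fun j => (T.singularValues j)⁻¹ • T (q j)
  have hzero : ∀ j : Fin n, T.singularValues j = 0 → T (q j) = 0 := by
    intro j hj
    have := hq j j
    rw [if_pos rfl, hj] at this
    exact inner_self_eq_zero.1 (this.trans (by norm_num))
  have horth : Orthonormal ℝ fun j : {j : Fin n // T.singularValues j ≠ 0} => p j := by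
    rw [orthonormal_iff_ite]
    rintro ⟨i, hi⟩ ⟨j, hj⟩
    simp only [p, inner_smul_left, inner_smul_right, hq, Subtype.mk.injEq]
    split_ifs with h
    · subst h
      simp
      field_simp
    · simp
  refine ⟨q, p, fun j => ?_, fun j => ?_, fun y => ?_⟩
  · by_cases hj : T.singularValues j = 0
    · rw [hzero j hj, hj, zero_smul]
    · rw [smul_inv_smul₀ hj]
  · by_cases hj : T.singularValues j = 0
    · simp [p, hj]
    · exact (horth.1 ⟨j, hj⟩).le
  · have h := horth.sum_inner_products_le (s := Finset.univ) y
    simp only [Real.norm_eq_abs, sq_abs] at h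
    refine le_trans (le_of_eq ?_) h
    rw [← Finset.sum_subtype (Finset.univ.filter fun j : Fin n => T.singularValues j ≠ 0)
      (by simp) fun j => inner ℝ (p j) y ^ 2]
    refine (Finset.sum_filter_of_ne fun j _ => mt fun hj0 => ?_).symm
    simp [p, hj0]

/-- **Von Neumann's trace inequality**, for the operator `∑ i, w i • ⟨v i, ·⟩ u i` with decreasing
nonnegative weights `w`, against an arbitrary `T`. The weights are a sequence vanishing from `m` on,
so that they can be compared with the sequence of singular values of `T`. -/
theorem sum_mul_inner_map_le (T : E →ₗ[ℝ] F) {m : ℕ} {u : Fin m → F} {v : Fin m → E}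
    (hu : Orthonormal ℝ u) (hv : Orthonormal ℝ v) {w : ℕ → ℝ} (hw : Antitone w)
    (hw0 : ∀ k, 0 ≤ w k) (hwm : ∀ k, m ≤ k → w k = 0) :
    ∑ i : Fin m, w i * inner ℝ (u i) (T (v i)) ≤ ∑ i : Fin m, w i * T.singularValues i := by
  obtain ⟨n, hn⟩ : ∃ n, Module.finrank ℝ E = n := ⟨_, rfl⟩
  obtain ⟨q, p, hqp, hp1, hp⟩ := exists_singular_vectors T hn
  have hT : ∀ i, inner ℝ (u i) (T (v i)) =
      ∑ j : Fin n, T.singularValues j * (inner ℝ (q j) (v i) * inner ℝ (p j) (u i)) := by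
    intro i
    conv_lhs => rw [← q.sum_repr' (v i)]
    simp only [map_sum, map_smul, hqp, inner_sum, inner_smul_right, real_inner_comm (p _) (u i)]
    exact Finset.sum_congr rfl fun j _ => by ring
  have hqrow : ∀ i, ∑ j, inner ℝ (q j) (v i) ^ 2 = 1 := by
    intro i
    have h := q.sum_sq_norm_inner_right (v i)
    simpa [hv.1 i] using h
  have hprow : ∀ i, ∑ j, inner ℝ (p j) (u i) ^ 2 ≤ 1 := by
    intro i
    simpa [hu.1 i] using hp (u i)
  have hqcol : ∀ j, ∑ i, inner ℝ (q j) (v i) ^ 2 ≤ 1 := by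
    intro j
    have h := hv.sum_inner_products_le (s := Finset.univ) (q j)
    simpa [real_inner_comm] using h
  have hpcol : ∀ j, ∑ i, inner ℝ (p j) (u i) ^ 2 ≤ 1 := by
    intro j
    have h := hu.sum_inner_products_le (s := Finset.univ) (p j)
    simp only [Real.norm_eq_abs, sq_abs, real_inner_comm (p j)] at h
    exact h.trans (pow_le_one₀ (norm_nonneg _) (hp1 j))
  -- AM-GM replaces the products in `hT` by the entries of a doubly substochastic matrix.
  let D : Fin m → Fin n → ℝ := fun i j =>
    (inner ℝ (q j) (v i) ^ 2 + inner ℝ (p j) (u i) ^ 2) / 2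
  calc ∑ i : Fin m, w i * inner ℝ (u i) (T (v i))
      ≤ ∑ i : Fin m, ∑ j : Fin n, w i * T.singularValues j * D i j := by
        simp only [hT, Finset.mul_sum]
        refine Finset.sum_le_sum fun i _ => Finset.sum_le_sum fun j _ => ?_
        rw [← mul_assoc]
        refine mul_le_mul_of_nonneg_left ?_ (mul_nonneg (hw0 _) (T.singularValues_nonneg _))
        simp only [D]
        linarith [two_mul_le_add_sq (inner ℝ (q j) (v i)) (inner ℝ (p j) (u i))]
    _ ≤ ∑ i : Fin m, w i * T.singularValues i := by
        refine sum_mul_mul_substochastic_le hw hw0 T.singularValues_antitone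
          T.singularValues_nonneg hwm (fun i j => by positivity) (fun i => ?_) (fun j => ?_)
        · simp only [D]
          rw [← Finset.sum_div, Finset.sum_add_distrib]
          linarith [hqrow i, hprow i]
        · simp only [D]
          rw [← Finset.sum_div, Finset.sum_add_distrib]
          linarith [hqcol j, hpcol j]

end LinearMap

/-! ### Singular values of matrices -/

section Matrix

variable {m n : ℕ}

lemma inner_eq_sum (X Y : Matrix (Fin m) (Fin n) ℝ) :
    inner ℝ X Y = ∑ i, ∑ j, X i j * Y i j :=
  rfl

lemma inner_vecMulVec (u : Fin m → ℝ) (v : Fin n → ℝ) (G : Matrix (Fin m) (Fin n) ℝ) :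
    inner ℝ (Matrix.vecMulVec u v) G = u ⬝ᵥ (G *ᵥ v) := by
  simp [inner_eq_sum, Matrix.vecMulVec_apply, Matrix.mulVec, dotProduct, Finset.mul_sum, mul_assoc,
    mul_comm (v _)]

lemma sigma_nonneg (X : Matrix (Fin m) (Fin n) ℝ) (i : Fin m) : 0 ≤ sigma X i :=
  (Matrix.toEuclideanLin X).singularValues_nonneg i

/-- Of the `n` eigenvalues of `Yᵀ * Y`, the first `m` are the squares of the `sigma Y i`; the other
`n - m` vanish because the rank of `Y` is at most `m`. -/
lemma sum_sigma_sq (hmn : m ≤ n) (Y : Matrix (Fin m) (Fin n) ℝ) :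
    ∑ i, sigma Y i ^ 2 = ‖Y‖ ^ 2 := by
  have h := sum_norm_map_sq_eq_sum_singularValues_sq (Matrix.toEuclideanLin Y)
    (EuclideanSpace.basisFun (Fin n) ℝ)
  have hzero : ∀ k, m ≤ k → (Matrix.toEuclideanLin Y).singularValues k = 0 := by
    intro k hk
    rw [LinearMap.singularValues_eq_zero_iff_le_finrank_range]
    exact (Submodule.finrank_le _).trans (by simpa using hk)
  have hsum : ∑ i : Fin n, (Matrix.toEuclideanLin Y).singularValues i ^ 2
      = ∑ i, sigma Y i ^ 2 := by
    simp only [sigma]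
    rw [Fin.sum_univ_eq_sum_range (fun k => (Matrix.toEuclideanLin Y).singularValues k ^ 2) n,
      Fin.sum_univ_eq_sum_range (fun k => (Matrix.toEuclideanLin Y).singularValues k ^ 2) m]
    refine (Finset.sum_subset (Finset.range_mono hmn) fun k _ hk => ?_).symm
    rw [hzero k (by simpa using hk)]
    norm_num
  rw [← hsum, ← h, ← real_inner_self_eq_norm_sq, inner_eq_sum, Finset.sum_comm]
  refine Finset.sum_congr rfl fun j _ => ?_
  rw [EuclideanSpace.norm_sq_eq]
  refine Finset.sum_congr rfl fun i _ => ?_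
  simp [Matrix.toLpLin_apply, pow_two]

lemma orthonormal_col {k l : ℕ} {U : Matrix (Fin k) (Fin l) ℝ} (hU : Uᵀ * U = 1) :
    Orthonormal ℝ fun i : Fin l => WithLp.toLp 2 (Uᵀ i) := by
  rw [orthonormal_iff_ite]
  intro i j
  have h := congrFun (congrFun hU i) j
  rw [Matrix.mul_apply, Matrix.one_apply] at h
  rw [← h]
  simp [PiLp.inner_apply, mul_comm]

lemma inner_mul_diagonal_mul_transpose (U : Matrix (Fin m) (Fin m) ℝ)
    (V : Matrix (Fin n) (Fin m) ℝ) (d : Fin m → ℝ) (Y : Matrix (Fin m) (Fin n) ℝ) :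
    inner ℝ (U * Matrix.diagonal d * Vᵀ) Y =
      ∑ k, d k * inner ℝ (WithLp.toLp 2 (Uᵀ k))
        (Matrix.toEuclideanLin Y (WithLp.toLp 2 (Vᵀ k))) := by
  have hR : ∀ k, inner ℝ (WithLp.toLp 2 (Uᵀ k))
      (Matrix.toEuclideanLin Y (WithLp.toLp 2 (Vᵀ k))) =
        ∑ i, ∑ j, U i k * (Y i j * V j k) := by
    intro k
    simp [PiLp.inner_apply, Matrix.toLpLin_apply, Matrix.mulVec, dotProduct, Finset.mul_sum,
      mul_comm]
  simp only [hR, inner_eq_sum, Matrix.mul_apply (M := U * _), Matrix.mul_diagonal,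
    Matrix.transpose_apply, Finset.mul_sum, Finset.sum_mul]
  rw [Finset.sum_comm (s := (Finset.univ : Finset (Fin m)))
    (f := fun k i => ∑ j, d k * (U i k * (Y i j * V j k)))]
  refine Finset.sum_congr rfl fun i _ => ?_
  rw [Finset.sum_comm]
  refine Finset.sum_congr rfl fun k _ => Finset.sum_congr rfl fun j _ => ?_
  ring

lemma inner_mul_diagonal_mul_transpose_self {S : Matrix (Fin m) (Fin n) ℝ}
    {U : Matrix (Fin m) (Fin m) ℝ} {V : Matrix (Fin n) (Fin m) ℝ} (h : IsSVD S U V)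
    (d : Fin m → ℝ) :
    inner ℝ (U * Matrix.diagonal d * Vᵀ) S = ∑ k, d k * sigma S k := by
  obtain ⟨hU, hV, hS⟩ := h
  rw [inner_mul_diagonal_mul_transpose]
  refine Finset.sum_congr rfl fun k _ => ?_
  have hk : Matrix.toEuclideanLin S (WithLp.toLp 2 (Vᵀ k)) =
      sigma S k • WithLp.toLp 2 (Uᵀ k) := by
    have hSV : S * V = U * Matrix.diagonal (sigma S) := by
      conv_lhs => rw [hS]
      rw [Matrix.mul_assoc, hV, Matrix.mul_one]
    ext i
    have := congrFun (congrFun hSV i) k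
    rw [Matrix.mul_diagonal] at this
    simp [Matrix.toLpLin_apply, Matrix.mulVec, dotProduct]
    rw [mul_comm, ← this, Matrix.mul_apply]
  rw [hk, inner_smul_right, real_inner_self_eq_norm_sq, (orthonormal_col hU).1 k]
  ring

/-- If `θ` lies above its tangents of slopes `θ'` on `[0, ∞)`, and `θ'` is monotone and nonnegative
there, then `U Diag(θ'(σ(S))) Vᵀ` is a subgradient at `S` of `Y ↦ ∑ i, θ (σᵢ Y)`. -/
theorem spectral_subgradient {θ θ' : ℝ → ℝ} (hmono : MonotoneOn θ' (Set.Ici 0))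
    (hnonneg : ∀ x, 0 ≤ x → 0 ≤ θ' x)
    (htangent : ∀ x y, 0 ≤ x → 0 ≤ y → θ x + θ' x * (y - x) ≤ θ y)
    {S : Matrix (Fin m) (Fin n) ℝ} {U : Matrix (Fin m) (Fin m) ℝ} {V : Matrix (Fin n) (Fin m) ℝ}
    (h : IsSVD S U V) (Y : Matrix (Fin m) (Fin n) ℝ) :
    ∑ i, θ (sigma S i) + inner ℝ (U * Matrix.diagonal (fun i => θ' (sigma S i)) * Vᵀ) (Y - S) ≤
      ∑ i, θ (sigma Y i) := by
  let s := (Matrix.toEuclideanLin S).singularValues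
  have hs0 : ∀ k, 0 ≤ s k := (Matrix.toEuclideanLin S).singularValues_nonneg
  let w : ℕ → ℝ := fun k => if k < m then θ' (s k) else 0
  have hw0 : ∀ k, 0 ≤ w k := by
    intro k
    simp only [w]
    split_ifs
    exacts [hnonneg _ (hs0 k), le_rfl]
  have hw : Antitone w := by
    intro k l hkl
    by_cases hl : l < m
    · simp only [w, hl, hkl.trans_lt hl, if_true]
      exact hmono (hs0 l) (hs0 k) ((Matrix.toEuclideanLin S).singularValues_antitone hkl)
    · simpa [w, hl] using hw0 k
  have htrace := sum_mul_inner_map_le (Matrix.toEuclideanLin Y) (orthonormal_col h.1)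
    (orthonormal_col h.2.1) hw hw0 (fun k hk => if_neg (not_lt.2 hk))
  have hwσ : ∀ i : Fin m, w i = θ' (sigma S i) := fun i => if_pos i.2
  simp only [hwσ] at htrace
  rw [inner_sub_right, inner_mul_diagonal_mul_transpose_self h, inner_mul_diagonal_mul_transpose]
  have hsum : ∑ i, (θ (sigma S i) + θ' (sigma S i) * (sigma Y i - sigma S i)) ≤
      ∑ i, θ (sigma Y i) :=
    Finset.sum_le_sum fun i _ => htangent _ _ (sigma_nonneg S i) (sigma_nonneg Y i)
  simp only [mul_sub, Finset.sum_add_distrib, Finset.sum_sub_distrib] at hsum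
  change _ ≤ ∑ i, θ' (sigma S i) * sigma Y i at htrace
  linarith

end Matrix

/-! ### Differentiability of the regularizer -/

lemma tangent_le_of_monotoneOn_deriv {θ θ' : ℝ → ℝ}
    (hd : ∀ x, 0 ≤ x → HasDerivWithinAt θ (θ' x) (Set.Ici 0) x)
    (hmono : MonotoneOn θ' (Set.Ici 0)) {x y : ℝ} (hx : 0 ≤ x) (hy : 0 ≤ y) :
    θ x + θ' x * (y - x) ≤ θ y := by
  have hmvt : ∀ a b, 0 ≤ a → a < b → ∃ c ∈ Set.Ioo a b, θ' c * (b - a) = θ b - θ a := by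
    intro a b ha hab
    obtain ⟨c, hc, h⟩ := exists_hasDerivAt_eq_slope θ θ' hab
      (fun z hz => ((hd z (ha.trans hz.1)).continuousWithinAt).mono
        fun t ht => ha.trans ht.1)
      (fun z hz => (hd z (ha.trans hz.1.le)).hasDerivAt (Ici_mem_nhds (ha.trans_lt hz.1)))
    exact ⟨c, hc, by rw [h, div_mul_cancel₀ _ (sub_pos.2 hab).ne']⟩
  rcases lt_trichotomy x y with hxy | rfl | hxy
  · obtain ⟨c, hc, h⟩ := hmvt x y hx hxy
    have := hmono hx (hx.trans hc.1.le : (0 : ℝ) ≤ c) hc.1.le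
    nlinarith
  · simp
  · obtain ⟨c, hc, h⟩ := hmvt y x hy hxy
    have := hmono (hy.trans hc.1.le : (0 : ℝ) ≤ c) hx hc.2.le
    nlinarith

section Penalty

variable {m n : ℕ} {κ : ℝ → ℝ} {ρ : ℝ≥0}

lemma IsPenalty.hasDerivWithinAt (hκ : IsPenalty κ ρ) {x : ℝ} (hx : 0 ≤ x) :
    HasDerivWithinAt κ (kappaDeriv κ x) (Set.Ici 0) x :=
  (hκ.differentiable x hx).hasDerivWithinAt

lemma IsPenalty.antitoneOn_kappaDeriv (hκ : IsPenalty κ ρ) :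
    AntitoneOn (kappaDeriv κ) (Set.Ici 0) :=
  hκ.concave.antitoneOn_derivWithin hκ.differentiable

/-- The derivative of `x ↦ ρ / 2 * x ^ 2 - (κ'(0) x - κ x)` is monotone. -/
lemma IsPenalty.monotoneOn_mul_sub (hκ : IsPenalty κ ρ) :
    MonotoneOn (fun x => ρ * x - (kappaDeriv κ 0 - kappaDeriv κ x)) (Set.Ici 0) := by
  intro x hx y hy hxy
  have h := hκ.lipschitz_deriv.dist_le_mul x hx y hy
  rw [dist_comm x y, Real.dist_eq, Real.dist_eq, abs_of_nonneg (sub_nonneg.2 hxy)] at h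
  have := le_abs_self (kappaDeriv κ x - kappaDeriv κ y)
  simp only
  linarith

/-- The first-order remainder of the spectral sum is quadratically small: one side is the
subgradient inequality for `x ↦ κ'(0) x - κ x`, the other that for its difference from
`ρ / 2 * x ^ 2`. -/
lemma IsPenalty.abs_spectral_remainder_le (hκ : IsPenalty κ ρ) (hmn : m ≤ n)
    {S : Matrix (Fin m) (Fin n) ℝ} {U : Matrix (Fin m) (Fin m) ℝ} {V : Matrix (Fin n) (Fin m) ℝ}
    (h : IsSVD S U V) (Y : Matrix (Fin m) (Fin n) ℝ) :
    |∑ i, (κ (sigma Y i) - kappaDeriv κ 0 * sigma Y i)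
        - ∑ i, (κ (sigma S i) - kappaDeriv κ 0 * sigma S i)
        - inner ℝ (U * Matrix.diagonal (fun i => kappaDeriv κ (sigma S i) - kappaDeriv κ 0) * Vᵀ)
          (Y - S)| ≤ ρ / 2 * ‖Y - S‖ ^ 2 := by
  set κ₀ := kappaDeriv κ 0 with hκ₀
  have hmono₁ : MonotoneOn (fun x => κ₀ - kappaDeriv κ x) (Set.Ici 0) := fun x hx y hy hxy =>
    sub_le_sub_left (hκ.antitoneOn_kappaDeriv hx hy hxy) _
  have hmono₂ := hκ.monotoneOn_mul_sub
  have hd₁ : ∀ x, 0 ≤ x →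
      HasDerivWithinAt (fun x => κ₀ * x - κ x) (κ₀ - kappaDeriv κ x) (Set.Ici 0) x := by
    intro x hx
    refine HasDerivWithinAt.sub ?_ (hκ.hasDerivWithinAt hx)
    simpa using (hasDerivWithinAt_id x _).const_mul κ₀
  have hd₂ : ∀ x, 0 ≤ x → HasDerivWithinAt (fun x => ρ / 2 * x ^ 2 - (κ₀ * x - κ x))
      (ρ * x - (κ₀ - kappaDeriv κ x)) (Set.Ici 0) x := by
    intro x hx
    refine HasDerivWithinAt.sub ?_ (hd₁ x hx)
    convert! (((hasDerivAt_id x).pow 2).const_mul ((ρ : ℝ) / 2)).hasDerivWithinAt using 1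
    simp
    ring
  have hmem : (0 : ℝ) ∈ Set.Ici (0 : ℝ) := Set.self_mem_Ici
  have h₁ := spectral_subgradient hmono₁
    (fun x hx => by simpa [hκ₀] using hmono₁ hmem hx hx)
    (fun x y hx hy => tangent_le_of_monotoneOn_deriv hd₁ hmono₁ hx hy) h Y
  have h₂ := spectral_subgradient hmono₂
    (fun x hx => by simpa using hmono₂ hmem hx hx)
    (fun x y hx hy => tangent_le_of_monotoneOn_deriv hd₂ hmono₂ hx hy) h Y
  simp only [inner_mul_diagonal_mul_transpose] at h₁ h₂ ⊢
  have hquad : ∑ k, sigma S k * inner ℝ (WithLp.toLp 2 (Uᵀ k))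
      (Matrix.toEuclideanLin (Y - S) (WithLp.toLp 2 (Vᵀ k))) = inner ℝ S (Y - S) := by
    conv_rhs => rw [h.2.2]
    rw [inner_mul_diagonal_mul_transpose, ← h.2.2]
  have hnorm : ‖Y - S‖ ^ 2 = ‖Y‖ ^ 2 - ‖S‖ ^ 2 - 2 * inner ℝ S (Y - S) := by
    rw [norm_sub_sq_real, inner_sub_right, real_inner_self_eq_norm_sq, real_inner_comm]
    ring
  rw [hnorm, ← hquad, ← sum_sigma_sq hmn Y, ← sum_sigma_sq hmn S]
  simp only [sub_mul, mul_assoc, Finset.sum_sub_distrib, ← Finset.mul_sum, ← hκ₀] at h₁ h₂ ⊢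
  rw [abs_le]
  constructor <;> linarith

theorem IsPenalty.hasGradientAt_gBar (hκ : IsPenalty κ ρ) (hmn : m ≤ n) (μ : ℝ)
    {S : Matrix (Fin m) (Fin n) ℝ} {U : Matrix (Fin m) (Fin m) ℝ} {V : Matrix (Fin n) (Fin m) ℝ}
    (h : IsSVD S U V) :
    HasGradientAt (gBar κ μ) (μ • (U * Matrix.diagonal
      (fun i => kappaDeriv κ (sigma S i) - kappaDeriv κ 0) * Vᵀ)) S := by
  have h₁ : HasGradientAt
      (fun Y : Matrix (Fin m) (Fin n) ℝ => ∑ i, (κ (sigma Y i) - kappaDeriv κ 0 * sigma Y i))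
      (U * Matrix.diagonal (fun i => kappaDeriv κ (sigma S i) - kappaDeriv κ 0) * Vᵀ) S := by
    rw [hasGradientAt_iff_isLittleO]
    refine Asymptotics.IsBigO.trans_isLittleO (g := fun Y => ‖Y - S‖ ^ 2) ?_ ?_
    · refine Asymptotics.IsBigO.of_bound (ρ / 2) (Filter.Eventually.of_forall fun Y => ?_)
      simpa using hκ.abs_spectral_remainder_le hmn h Y
    · exact Asymptotics.isLittleO_pow_sub_sub S one_lt_two
  rw [hasGradientAt_iff_hasFDerivAt] at h₁ ⊢
  rw [map_smul]
  exact h₁.const_mul μ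

end Penalty

lemma hasDerivAt_comp_of_hasGradientAt {H : Type*} [NormedAddCommGroup H] [InnerProductSpace ℝ H]
    [CompleteSpace H] {F : H → ℝ} {g x : H} {c : ℝ → H} {c' : H} {t : ℝ} (hx : c t = x)
    (hF : HasGradientAt F g x) (hc : HasDerivAt c c' t) :
    HasDerivAt (fun s => F (c s)) (inner ℝ c' g) t := by
  subst hx
  rw [real_inner_comm]
  exact hF.hasFDerivAt.comp_hasDerivAt t hc

end LowRankGradient

theorem proposition6 {m n : ℕ} (hmn : m ≤ n)
    (f : Matrix (Fin m) (Fin n) ℝ → ℝ) (L : ℝ≥0) (hf : LowRankGradient.IsLipschitzSmooth f L)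
    (κ : ℝ → ℝ) (ρ : ℝ≥0) (hκ : LowRankGradient.IsPenalty κ ρ)
    (μ : ℝ) (hμ : 0 ≤ μ)
    (X : Matrix (Fin m) (Fin n) ℝ) (u : Fin m → ℝ) (v : Fin n → ℝ) (α β : ℝ)
    (S : Matrix (Fin m) (Fin n) ℝ) (hS : S = α • X + β • Matrix.vecMulVec u v)
    (U : Matrix (Fin m) (Fin m) ℝ) (V : Matrix (Fin n) (Fin m) ℝ)
    (hSVD : LowRankGradient.IsSVD S U V) :
    HasGradientAt (LowRankGradient.fBar f κ μ)
        (∇ f S + μ • (U * Matrix.diagonal (fun i =>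
          LowRankGradient.kappaDeriv κ (LowRankGradient.sigma S i)
            - LowRankGradient.kappaDeriv κ 0) * Vᵀ)) S ∧
      HasDerivAt (fun a : ℝ => LowRankGradient.fBar f κ μ (a • X + β • Matrix.vecMulVec u v))
        (inner ℝ X (∇ (LowRankGradient.fBar f κ μ) S)) α ∧
      HasDerivAt (fun b : ℝ => LowRankGradient.fBar f κ μ (α • X + b • Matrix.vecMulVec u v))
        (u ⬝ᵥ (∇ (LowRankGradient.fBar f κ μ) S *ᵥ v)) β := by
  have hgrad : HasGradientAt (LowRankGradient.fBar f κ μ)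
      (∇ f S + μ • (U * Matrix.diagonal (fun i =>
        LowRankGradient.kappaDeriv κ (LowRankGradient.sigma S i)
          - LowRankGradient.kappaDeriv κ 0) * Vᵀ)) S := by
    have hf' := hf.1 S
    have hg := hκ.hasGradientAt_gBar hmn μ hSVD
    rw [hasGradientAt_iff_hasFDerivAt] at hf' hg ⊢
    rw [map_add]
    exact hf'.add hg
  have hline : ∀ (c t : ℝ) (A B : Matrix (Fin m) (Fin n) ℝ),
      HasDerivAt (fun a : ℝ => a • A + c • B) A t := fun c t A B =>
    HasDerivAt.add_const _ (by simpa using (hasDerivAt_id t).smul_const A)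
  rw [hgrad.gradient]
  refine ⟨hgrad, ?_, ?_⟩
  · exact LowRankGradient.hasDerivAt_comp_of_hasGradientAt hS.symm hgrad (hline β α X _)
  · rw [← LowRankGradient.inner_vecMulVec]
    simp only [add_comm (α • X)] at hS ⊢
    exact LowRankGradient.hasDerivAt_comp_of_hasGradientAt hS.symm hgrad (hline α β _ X)
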